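/- \textbf{Theorem.} Consider an agent $x(t+1)=Ax(t)+Bu(t)$, $y(t)=Cx(t)$ with $x(t)\in\mathbb R^{n}$, $u(t)\in\mathbb R^{m}$, $y(t)\in\mathbb R^{q}$, $t\in\mathbb N$, where $(A,B)$ is controllable, under the constraint $(x(t),u(t))\in\mathbb Z$, where $\mathbb Z=\{z: Hz\le h\}$ is a polytope (not necessarily bounded) containing the origin in its interior. Let the exosystem be $w(t+1)=Sw(t)$, $y^r(t)=Q_e w(t)$ with $S^\rho=I$ for some integer $\rho\ge 1$, suppose that $\begin{bmatrix}A-\lambda I&B\\ C&0\end{bmatrix}$ has full row rank for every eigenvalue $\lambda$ of $S$, and let $e(t)=y(t)-y^r(t)=Cx(t)-Q_ew(t)$ be the tracking error. Let $K$ be such that $A^c=A+BK$ is Schur, let $\Pi,\Gamma$ satisfy $A\Pi+B\Gamma=\Pi S$ and $C\Pi=Q_e$, put $L=\Gamma-K\Pi$, and let $0<\epsilon<1$. Define sets of pairs $(x,w)$ by $$\mathcal O_0=\{(x,w):(x,Kx+Lw)\in(1-\epsilon)\mathbb Z\},\qquad \mathcal O_k=\{(x,w)\in\mathcal O_0:(A^cx+BLw,\,Sw)\in\mathcal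 O_{k-1}\}\quad(k\ge 1),$$ let $\mathcal O_\infty=\bigcap_{k}\mathcal O_k$ be the limit of this decreasing sequence, and let $\mathcal R_\infty=\{w:\exists x,\ (x,w)\in\mathcal O_\infty\}$ be the set of admissible references. Write $\|z\|_M^2=z^\top Mz$. Let $Q,R,T^0$ be symmetric positive definite, $P$ the solution of $(A^c)^\top PA^c-P+Q=0$, and $T=\sum_{k=1}^{\rho}(S^k)^\top T^0S^k$. For a horizon $N\ge 1$, a state $x$ and a reference $w$, let $\mathbb{QP}(x,w)$ be the problem of minimizing $$\|\bar w(0)-w\|_T^2+\sum_{k=0}^{N-1}\|x(k)-\Pi\bar w(k)\|_Q^2+\sum_{k=0}^{N-1}\|v(k)\|_R^2+\|x(N)-\Pi\bar w(N)\|_P^2$$ over $\bar w(0),\dots,\bar w(N)$, $v(0),\dots,v(N-1)$, $x(0),\dots,x(N)$ subject to $x(0)=x$ and, for $k=0,\dots,N-1$, $$x(k+1)=A^cx(k)+BL\bar w(k)+Bv(k),\quad \bar w(k+1)=S\bar w(k),\quad \big(x(k),\,Kx(k)+L\bar w(k)+v(k)\big)\in\mathbb Z,$$ and $(x(N),\bar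 w(N))\in\mathcal O_\infty$. Feasibility of $\mathbb{QP}(x,w)$ depends on $x$ only. The MPC law is $\kappa(x,w)=Kx+L\bar w^*(0)+v^*(0)$, where $(\bar w^*,v^*,x^*)$ is the optimal solution of $\mathbb{QP}(x,w)$. Suppose that $N\ge n$, that $\mathbb{QP}(x(t),w(t))$ is feasible at some time $t$, and that $u(s)=\kappa(x(s),w(s))$ for all $s\ge t$, where $w(t),w(t+1),\dots$ is an arbitrary sequence of references (in particular, $w(s+1)\ne Sw(s)$ is allowed). Then, for all $s\ge t$, $\mathbb{QP}(x(s),w(s))$ has exactly one optimal solution, and (i) (constraint satisfaction) $(x(s),u(s))\in\mathbb Z$ for all $s\ge t$; (ii) (recursive feasibility) $\mathbb{QP}$ is feasible at time $s+1$ for all $s\ge t$; in particular it is feasible at $t+1$; (iii) (convergence) if moreover $w(s+1)=Sw(s)$ for all $s\ge t$ and $w(t)\in\mathcal R_\infty$, then $e(s)\to0$ as $s\to\infty$. -/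

import Mathlib

open scoped Matrix Pointwise Topology
open Filter

/-- A pair `(A, B)` is controllable: the Kalman matrix `[B, AB, …, A^(n-1) B]` has rank `n`. -/
def IsControllablePair {n m : ℕ} (A : Matrix (Fin n) (Fin n) ℝ) (B : Matrix (Fin n) (Fin m) ℝ) :
    Prop :=
  (Matrix.of fun (i : Fin n) (kj : Fin n × Fin m) => (A ^ (kj.1 : ℕ) * B) i kj.2).rank = n

/-- A real square matrix is Schur: all its (complex) eigenvalues lie in the open unit disc. -/
def IsSchur {n : ℕ} (F : Matrix (Fin n) (Fin n) ℝ) : Prop :=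
  ∀ z ∈ spectrum ℂ (F.map (algebraMap ℝ ℂ)), ‖z‖ < 1

/-- A polytope: a set of the form `{z | H z ≤ h}` (finitely many linear inequalities). -/
def IsPolytope {ι : Type} [Fintype ι] (Z : Set (ι → ℝ)) : Prop :=
  ∃ (r : ℕ) (H : Matrix (Fin r) ι ℝ) (h : Fin r → ℝ), Z = {z | H *ᵥ z ≤ h}

/-- The weighted square `‖x‖_T² = xᵀ T x`. -/
def sqWeight {ι : Type} [Fintype ι] (T : Matrix ι ι ℝ) (x : ι → ℝ) : ℝ :=
  x ⬝ᵥ (T *ᵥ x)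

/-- The data of one agent, of its exosystem, and of its model predictive controller:
state, input, output and reference dimensions are `n`, `m`, `q`, `p`; `N` is the horizon. -/
structure MPCAgent (n m q p N : ℕ) where
  /-- plant: `x⁺ = A x + B u`, `y = C x` -/
  A : Matrix (Fin n) (Fin n) ℝ
  B : Matrix (Fin n) (Fin m) ℝ
  C : Matrix (Fin q) (Fin n) ℝ
  /-- set of admissible stacked vectors `(x, u)` -/
  Z : Set (Fin n ⊕ Fin m → ℝ)
  /-- exosystem: `w⁺ = S w`, `yʳ = Qe w` -/
  S : Matrix (Fin p) (Fin p) ℝ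
  Qe : Matrix (Fin q) (Fin p) ℝ
  ρ : ℕ
  /-- stabilizing gain -/
  K : Matrix (Fin m) (Fin n) ℝ
  /-- solution of the regulator equations -/
  Pi : Matrix (Fin n) (Fin p) ℝ
  Gam : Matrix (Fin m) (Fin p) ℝ
  /-- constraint tightening -/
  ε : ℝ
  /-- weights of the cost -/
  Q : Matrix (Fin n) (Fin n) ℝ
  R : Matrix (Fin m) (Fin m) ℝ
  P : Matrix (Fin n) (Fin n) ℝ
  T₀ : Matrix (Fin p) (Fin p) ℝ

/-- Predicted sequences over the horizon: artificial references `w̄(0), …, w̄(N)`, auxiliary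
controls `v(0), …, v(N-1)`, states `x(0), …, x(N)`. -/
structure MPCPlan (n m p N : ℕ) where
  W : Fin (N + 1) → Fin p → ℝ
  V : Fin N → Fin m → ℝ
  X : Fin (N + 1) → Fin n → ℝ

instance {n m p N : ℕ} : Nonempty (MPCPlan n m p N) :=
  ⟨⟨fun _ => 0, fun _ => 0, fun _ => 0⟩⟩

namespace MPCAgent

variable {n m q p N : ℕ}

/-- The closed-loop matrix `Aᶜ = A + B K`. -/
def Ac (D : MPCAgent n m q p N) : Matrix (Fin n) (Fin n) ℝ := D.A + D.B * D.K

/-- The feedforward gain `L = Gam - K Pi`. -/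
def L (D : MPCAgent n m q p N) : Matrix (Fin m) (Fin p) ℝ := D.Gam - D.K * D.Pi

/-- The weight `T = ∑_{k=1}^ρ (Sᵏ)ᵀ T₀ Sᵏ`. -/
def T (D : MPCAgent n m q p N) : Matrix (Fin p) (Fin p) ℝ :=
  ∑ k ∈ Finset.Icc 1 D.ρ, (D.S ^ k)ᵀ * D.T₀ * D.S ^ k

/-- The standing assumptions on the agent, its exosystem and the design parameters. -/
structure Standing (D : MPCAgent n m q p N) : Prop where
  controllable : IsControllablePair D.A D.B
  polytope : IsPolytope D.Z
  zero_mem_interior : (0 : Fin n ⊕ Fin m → ℝ) ∈ interior D.Z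
  period_pos : 1 ≤ D.ρ
  periodic : D.S ^ D.ρ = 1
  full_row_rank : ∀ z ∈ spectrum ℂ (D.S.map (algebraMap ℝ ℂ)),
    (Matrix.fromBlocks (D.A.map (algebraMap ℝ ℂ) - z • (1 : Matrix (Fin n) (Fin n) ℂ))
      (D.B.map (algebraMap ℝ ℂ)) (D.C.map (algebraMap ℝ ℂ)) 0).rank = n + q
  schur : IsSchur D.Ac
  regulator_state : D.A * D.Pi + D.B * D.Gam = D.Pi * D.S
  regulator_output : D.C * D.Pi = D.Qe
  tightening_pos : 0 < D.ε
  tightening_lt_one : D.ε < 1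
  posDef_Q : D.Q.PosDef
  posDef_R : D.R.PosDef
  lyapunov : D.Acᵀ * D.P * D.Ac - D.P + D.Q = 0
  posDef_T₀ : D.T₀.PosDef

/-- The `k`-step admissible set `O_k` of pairs `(x, w)`. -/
def admissible (D : MPCAgent n m q p N) : ℕ → Set ((Fin n → ℝ) × (Fin p → ℝ))
  | 0 => {xw | Sum.elim xw.1 (D.K *ᵥ xw.1 + D.L *ᵥ xw.2) ∈ (1 - D.ε) • D.Z}
  | k + 1 => {xw | Sum.elim xw.1 (D.K *ᵥ xw.1 + D.L *ᵥ xw.2) ∈ (1 - D.ε) • D.Z ∧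
      (D.Ac *ᵥ xw.1 + (D.B * D.L) *ᵥ xw.2, D.S *ᵥ xw.2) ∈ D.admissible k}

/-- The maximal constraint admissible set `O_∞`, the limit of the decreasing sequence `O_k`. -/
def maxAdmissible (D : MPCAgent n m q p N) : Set ((Fin n → ℝ) × (Fin p → ℝ)) :=
  ⋂ k, D.admissible k

/-- The set `R_∞` of admissible references. -/
def admissibleRefs (D : MPCAgent n m q p N) : Set (Fin p → ℝ) :=
  {w | ∃ x, (x, w) ∈ D.maxAdmissible}

/-- `ξ` satisfies the constraints of the quadratic program at the measured state `x`. -/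
structure IsFeasiblePlan (D : MPCAgent n m q p N) (x : Fin n → ℝ) (ξ : MPCPlan n m p N) :
    Prop where
  initial : ξ.X 0 = x
  dynamics_state : ∀ k : Fin N, ξ.X k.succ =
    D.Ac *ᵥ ξ.X k.castSucc + (D.B * D.L) *ᵥ ξ.W k.castSucc + D.B *ᵥ ξ.V k
  dynamics_ref : ∀ k : Fin N, ξ.W k.succ = D.S *ᵥ ξ.W k.castSucc
  stage : ∀ k : Fin N, Sum.elim (ξ.X k.castSucc)
    (D.K *ᵥ ξ.X k.castSucc + D.L *ᵥ ξ.W k.castSucc + ξ.V k) ∈ D.Z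
  terminal : (ξ.X (Fin.last N), ξ.W (Fin.last N)) ∈ D.maxAdmissible

/-- The quadratic program is feasible at the measured state `x`. -/
def Feasible (D : MPCAgent n m q p N) (x : Fin n → ℝ) : Prop :=
  ∃ ξ, D.IsFeasiblePlan x ξ

/-- The cost of the plan `ξ` for the reference `w`. -/
def cost (D : MPCAgent n m q p N) (w : Fin p → ℝ) (ξ : MPCPlan n m p N) : ℝ :=
  sqWeight D.T (ξ.W 0 - w)
    + ∑ k : Fin N, sqWeight D.Q (ξ.X k.castSucc - D.Pi *ᵥ ξ.W k.castSucc)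
    + ∑ k : Fin N, sqWeight D.R (ξ.V k)
    + sqWeight D.P (ξ.X (Fin.last N) - D.Pi *ᵥ ξ.W (Fin.last N))

/-- `ξ` is an optimal solution of the quadratic program for the state `x` and reference `w`. -/
def IsOptimalPlan (D : MPCAgent n m q p N) (x : Fin n → ℝ) (w : Fin p → ℝ)
    (ξ : MPCPlan n m p N) : Prop :=
  D.IsFeasiblePlan x ξ ∧ ∀ η, D.IsFeasiblePlan x η → D.cost w ξ ≤ D.cost w η

/-- The optimal solution `(w̄*, v*, x*)`; an arbitrary plan if there is none. -/
noncomputable def optimalPlan (D : MPCAgent n m q p N) (x : Fin n → ℝ) (w : Fin p → ℝ) :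
    MPCPlan n m p N :=
  Classical.epsilon fun ξ => D.IsOptimalPlan x w ξ

/-- The controller `κ(x, w) = K x + L w̄*(0) + v*(0)`. -/
noncomputable def control [NeZero N] (D : MPCAgent n m q p N) (x : Fin n → ℝ)
    (w : Fin p → ℝ) : Fin m → ℝ :=
  D.K *ᵥ x + D.L *ᵥ (D.optimalPlan x w).W 0 + (D.optimalPlan x w).V 0

/-- The tracking error `e = y - yʳ = C x - Qe w`. -/
def trackingError (D : MPCAgent n m q p N) (x : Fin n → ℝ) (w : Fin p → ℝ) : Fin q → ℝ :=
  D.C *ᵥ x - D.Qe *ᵥ w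

end MPCAgent

/-!
The program `QP(x, w)` minimizes a quadratic cost over a closed convex set. The free decision
variables are `w̄(0)` and `v`, on which the cost is coercive and strictly convex because `T` and
`R` are positive definite (`P` is nonnegative since `Aᶜ` is Schur); hence the optimum exists and
is unique (`Standing.existsUnique_isOptimalPlan`).

The tail of a feasible plan, prolonged by the nominal law `v = 0`, is feasible at the next state,
because the maximal admissible set is invariant. If the reference follows the exosystem, which is
an isometry for `T`, the Lyapunov equation shows that the tail costs less by the first stage cost
(`Standing.exists_successor_plan`). This gives recursive feasibility, and it makes the optimal cost
decrease, so that `x - Pi w̄(0) → 0` along the closed loop.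

It remains to see that `w̄(0) - w → 0`. By periodicity of `S` and decay of `(Aᶜ)ᵏ`, both `w` and
`w̄(0)` have periodic regimes `(Pi Sᵏ w, Gam Sᵏ w)` inside the tightened set `(1 - ε) Z`
(`Standing.mem_steadyRefs_of_maxAdmissible`), and so has `w' = w̄(0) + lam (w - w̄(0))` by
convexity. As `N ≥ n`, a deadbeat input reaches the regime of `w'` exactly within the horizon, at a
cost quadratic in `x - Pi w'`; if `lam` and `x - Pi w̄(0)` are small, the tightening absorbs the
deviation (`Standing.exists_steering`). The move to `w'` lowers the offset cost
`‖w̄(0) - w‖_T²` to first order in `lam` and costs only second order in `lam` besides a multiple of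
`‖x - Pi w̄(0)‖²`. Optimality therefore bounds `‖w̄(0) - w‖_T²` by a constant times
`‖x - Pi w̄(0)‖²` (`Standing.exists_offset_le`), and the latter tends to zero.
The tracking error is `C (x - Pi w̄(0)) + Qe (w̄(0) - w)`.
-/

/-! ### Powers of Schur matrices -/

section SchurPowers

open scoped NNReal ENNReal

attribute [local instance] Matrix.linftyOpNormedRing Matrix.linftyOpNormedAlgebra

/-- By Gelfand's formula, the powers of a complex matrix whose eigenvalues all lie in the open
unit disc tend to zero. -/
theorem Matrix.tendsto_norm_pow_of_spectrum_lt_one {n : ℕ} (F : Matrix (Fin n) (Fin n) ℂ)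
    (hF : ∀ z ∈ spectrum ℂ F, ‖z‖ < 1) :
    Tendsto (fun k : ℕ => ‖F ^ k‖) atTop (𝓝 0) := by
  rcases subsingleton_or_nontrivial (Matrix (Fin n) (Fin n) ℂ) with hs | hs
  · have : ∀ k : ℕ, ‖F ^ k‖ = 0 := fun k => by rw [Subsingleton.elim (F ^ k) 0, norm_zero]
    simp [this]
  have : CompleteSpace (Matrix (Fin n) (Fin n) ℂ) := FiniteDimensional.complete ℂ _
  have hlt : spectralRadius ℂ F < ((1 : ℝ≥0) : ℝ≥0∞) :=
    spectrum.spectralRadius_lt_of_forall_lt F fun z hz => by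
      rw [← NNReal.coe_lt_coe]; simpa using hF z hz
  obtain ⟨r, hr0, hr1⟩ := ENNReal.lt_iff_exists_nnreal_btwn.mp hlt
  have hr1' : r < 1 := by exact_mod_cast hr1
  have hev := (spectrum.pow_nnnorm_pow_one_div_tendsto_nhds_spectralRadius F).eventually_lt_const hr0
  have hle : ∀ᶠ k : ℕ in atTop, ‖F ^ k‖ ≤ (r : ℝ) ^ k := by
    filter_upwards [hev, eventually_gt_atTop 0] with k hk hk0
    have hk0' : (0 : ℝ) < k := by exact_mod_cast hk0
    have h1 := ENNReal.rpow_le_rpow hk.le hk0'.le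
    rw [← ENNReal.rpow_mul, one_div, inv_mul_cancel₀ hk0'.ne', ENNReal.rpow_one,
      ENNReal.rpow_natCast] at h1
    exact_mod_cast h1
  exact squeeze_zero' (Eventually.of_forall fun k => norm_nonneg _) hle
    (tendsto_pow_atTop_nhds_zero_of_lt_one r.coe_nonneg (by exact_mod_cast hr1'))

theorem IsSchur.tendsto_pow_mulVec {n : ℕ} {F : Matrix (Fin n) (Fin n) ℝ} (hF : IsSchur F)
    (x : Fin n → ℝ) : Tendsto (fun k : ℕ => (F ^ k) *ᵥ x) atTop (𝓝 0) := by
  have h0 := Matrix.tendsto_norm_pow_of_spectrum_lt_one (F.map (algebraMap ℝ ℂ)) hF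
  have h1 := h0.mul_const ‖(algebraMap ℝ ℂ) ∘ x‖
  rw [zero_mul] at h1
  rw [tendsto_pi_nhds]
  intro i
  refine squeeze_zero_norm (fun k => ?_) h1
  have h2 : ((F ^ k).map (algebraMap ℝ ℂ) *ᵥ ((algebraMap ℝ ℂ) ∘ x)) i
      = algebraMap ℝ ℂ (((F ^ k) *ᵥ x) i) := (RingHom.map_mulVec _ _ _ _).symm
  have h3 : (F ^ k).map (algebraMap ℝ ℂ) = (F.map (algebraMap ℝ ℂ)) ^ k := Matrix.map_pow F _ k
  calc ‖((F ^ k) *ᵥ x) i‖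
      = ‖((F.map (algebraMap ℝ ℂ)) ^ k *ᵥ ((algebraMap ℝ ℂ) ∘ x)) i‖ := by
        rw [← h3, h2]; simp
    _ ≤ ‖(F.map (algebraMap ℝ ℂ)) ^ k *ᵥ ((algebraMap ℝ ℂ) ∘ x)‖ := norm_le_pi_norm _ i
    _ ≤ _ := Matrix.linfty_opNorm_mulVec _ _

end SchurPowers

/-! ### Quadratic forms -/

section Homogeneous

variable {E : Type*} [NormedAddCommGroup E] [NormedSpace ℝ E] {f : E → ℝ}

theorem eq_norm_sq_mul_of_homogeneous (hf : ∀ (c : ℝ) x, f (c • x) = c ^ 2 * f x) {x : E}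
    (hx : x ≠ 0) : f x = ‖x‖ ^ 2 * f (‖x‖⁻¹ • x) := by
  rw [hf, ← mul_assoc, ← mul_pow, mul_inv_cancel₀ (norm_ne_zero_iff.mpr hx), one_pow, one_mul]

variable [ProperSpace E]

theorem exists_le_mul_norm_sq_of_homogeneous (hc : Continuous f)
    (hf : ∀ (c : ℝ) x, f (c • x) = c ^ 2 * f x) : ∃ C, 0 ≤ C ∧ ∀ x, f x ≤ C * ‖x‖ ^ 2 := by
  obtain ⟨C, hC⟩ := (isCompact_sphere (0 : E) 1).exists_bound_of_continuousOn hc.continuousOn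
  refine ⟨max C 0, le_max_right _ _, fun x => ?_⟩
  rcases eq_or_ne x 0 with rfl | hx
  · have := hf 0 0
    simp_all
  · rw [eq_norm_sq_mul_of_homogeneous hf hx, mul_comm]
    have h1 : ‖x‖⁻¹ • x ∈ Metric.sphere (0 : E) 1 := by simp [norm_smul, hx]
    have h2 := (le_abs_self _).trans (hC _ h1)
    exact mul_le_mul_of_nonneg_right (h2.trans (le_max_left _ _)) (sq_nonneg _)

theorem exists_mul_norm_sq_le_of_homogeneous (hc : Continuous f)
    (hf : ∀ (c : ℝ) x, f (c • x) = c ^ 2 * f x) (hpos : ∀ x, x ≠ 0 → 0 < f x) :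
    ∃ c, 0 < c ∧ ∀ x, c * ‖x‖ ^ 2 ≤ f x := by
  obtain ⟨c, hc0, hc1⟩ := (isCompact_sphere (0 : E) 1).exists_forall_le' hc.continuousOn (a := 0)
    fun x hx => hpos x (by rintro rfl; simp at hx)
  refine ⟨c, hc0, fun x => ?_⟩
  rcases eq_or_ne x 0 with rfl | hx
  · have := hf 0 0
    simp_all
  · rw [eq_norm_sq_mul_of_homogeneous hf hx, mul_comm]
    have h1 : ‖x‖⁻¹ • x ∈ Metric.sphere (0 : E) 1 := by simp [norm_smul, hx]
    exact mul_le_mul_of_nonneg_left (hc1 _ h1) (sq_nonneg _)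

end Homogeneous

section SqWeight

variable {ι : Type} [Fintype ι] (M : Matrix ι ι ℝ)

@[fun_prop]
theorem continuous_sqWeight : Continuous (sqWeight M) := by
  unfold sqWeight; fun_prop

theorem sqWeight_smul (c : ℝ) (x : ι → ℝ) : sqWeight M (c • x) = c ^ 2 * sqWeight M x := by
  simp only [sqWeight, Matrix.mulVec_smul, dotProduct_smul, smul_dotProduct, smul_eq_mul]; ring

@[simp]
theorem sqWeight_zero : sqWeight M 0 = 0 := by simp [sqWeight]

/-- The parallelogram identity, from which strict convexity of the cost is read off. -/
theorem sqWeight_midpoint (a b : ι → ℝ) :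
    sqWeight M ((1 / 2 : ℝ) • (a + b))
      = (sqWeight M a + sqWeight M b) / 2 - sqWeight M (a - b) / 4 := by
  simp only [sqWeight, Matrix.mulVec_smul, dotProduct_smul, smul_dotProduct, smul_eq_mul,
    Matrix.mulVec_add, Matrix.mulVec_sub, dotProduct_add, add_dotProduct, dotProduct_sub,
    sub_dotProduct]
  ring

theorem sqWeight_conj (F : Matrix ι ι ℝ) (x : ι → ℝ) :
    sqWeight (Fᵀ * M * F) x = sqWeight M (F *ᵥ x) := by
  simp only [sqWeight, ← Matrix.mulVec_mulVec, Matrix.dotProduct_mulVec, Matrix.vecMul_transpose]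

variable {M}

theorem Matrix.PosDef.sqWeight_pos (hM : M.PosDef) {x : ι → ℝ} (hx : x ≠ 0) :
    0 < sqWeight M x := by
  simpa [sqWeight] using hM.dotProduct_mulVec_pos hx

theorem Matrix.PosDef.sqWeight_nonneg (hM : M.PosDef) (x : ι → ℝ) : 0 ≤ sqWeight M x := by
  rcases eq_or_ne x 0 with rfl | hx
  · simp
  · exact (hM.sqWeight_pos hx).le

theorem Matrix.PosDef.eq_zero_of_sqWeight_nonpos (hM : M.PosDef) {x : ι → ℝ} (hx : sqWeight M x ≤ 0) :
    x = 0 := by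
  by_contra h
  exact absurd (hM.sqWeight_pos h) hx.not_gt

theorem exists_mul_norm_sq_le_sqWeight (hM : ∀ x : ι → ℝ, x ≠ 0 → 0 < sqWeight M x) :
    ∃ c, 0 < c ∧ ∀ x : ι → ℝ, c * ‖x‖ ^ 2 ≤ sqWeight M x :=
  exists_mul_norm_sq_le_of_homogeneous (continuous_sqWeight M) (sqWeight_smul M) hM

end SqWeight

/-! ### Polytopes -/

section Polytope

variable {ι : Type} [Fintype ι] {Z : Set (ι → ℝ)}

theorem IsPolytope.convex (hZ : IsPolytope Z) : Convex ℝ Z := by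
  obtain ⟨r, H, h, rfl⟩ := hZ
  exact (convex_Iic h).linear_preimage H.mulVecLin

theorem IsPolytope.isClosed (hZ : IsPolytope Z) : IsClosed Z := by
  obtain ⟨r, H, h, rfl⟩ := hZ
  exact isClosed_le (by fun_prop) continuous_const

end Polytope

/-- Tightening a convex set by the factor `1 - ε` leaves room for perturbations from `ε • Z`. -/
theorem Convex.add_mem_of_mem_smul {E : Type*} [AddCommGroup E] [Module ℝ E] {Z : Set E}
    (hZ : Convex ℝ Z) {ε : ℝ} (h0 : 0 ≤ ε) (h1 : ε ≤ 1) {a b : E} (ha : a ∈ (1 - ε) • Z)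
    (hb : b ∈ ε • Z) : a + b ∈ Z := by
  obtain ⟨a, ha, rfl⟩ := ha
  obtain ⟨b, hb, rfl⟩ := hb
  exact hZ ha hb (by linarith) h0 (by ring)

/-! ### The weights of the cost -/

namespace MPCAgent

variable {n m q p N : ℕ} {D : MPCAgent n m q p N}

theorem sqWeight_T (D : MPCAgent n m q p N) (w : Fin p → ℝ) :
    sqWeight D.T w = ∑ k ∈ Finset.range D.ρ, sqWeight D.T₀ (D.S ^ (k + 1) *ᵥ w) := by
  rw [Finset.range_eq_Ico, Finset.sum_Ico_add' (fun k => sqWeight D.T₀ (D.S ^ k *ᵥ w)) 0 D.ρ 1]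
  simp only [← sqWeight_conj]
  simp only [T, sqWeight, Matrix.sum_mulVec, dotProduct_sum]
  rfl

namespace Standing

theorem sqWeight_T_pos (hD : D.Standing) {w : Fin p → ℝ} (hw : w ≠ 0) : 0 < sqWeight D.T w := by
  rw [sqWeight_T]
  have hmem : D.ρ - 1 ∈ Finset.range D.ρ := Finset.mem_range.mpr (by have := hD.period_pos; omega)
  refine Finset.sum_pos' (fun k _ => hD.posDef_T₀.sqWeight_nonneg _) ⟨D.ρ - 1, hmem, ?_⟩
  rw [Nat.sub_add_cancel hD.period_pos, hD.periodic, Matrix.one_mulVec]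
  exact hD.posDef_T₀.sqWeight_pos hw

theorem sqWeight_T_nonneg (hD : D.Standing) (w : Fin p → ℝ) : 0 ≤ sqWeight D.T w := by
  rw [sqWeight_T]
  exact Finset.sum_nonneg fun k _ => hD.posDef_T₀.sqWeight_nonneg _

/-- The exosystem is an isometry for the weight `T`, because `T` averages over a period. -/
theorem sqWeight_T_mulVec (hD : D.Standing) (w : Fin p → ℝ) :
    sqWeight D.T (D.S *ᵥ w) = sqWeight D.T w := by
  rw [sqWeight_T, sqWeight_T]
  have h : ∀ k, D.S ^ (k + 1) *ᵥ (D.S *ᵥ w) = D.S ^ (k + 1 + 1) *ᵥ w := fun k => by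
    rw [Matrix.mulVec_mulVec, ← pow_succ]
  simp only [h]
  have h2 := Finset.sum_range_succ' (fun k => sqWeight D.T₀ (D.S ^ (k + 1) *ᵥ w)) D.ρ
  rw [Finset.sum_range_succ, pow_succ, hD.periodic, one_mul, zero_add, pow_one] at h2
  linarith

theorem sqWeight_P_mulVec (hD : D.Standing) (z : Fin n → ℝ) :
    sqWeight D.P (D.Ac *ᵥ z) = sqWeight D.P z - sqWeight D.Q z := by
  have h := congrArg (fun M => sqWeight M z) hD.lyapunov
  simp only [sqWeight, Matrix.add_mulVec, Matrix.sub_mulVec, dotProduct_add, dotProduct_sub,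
    Matrix.zero_mulVec, dotProduct_zero] at h
  have h2 := sqWeight_conj D.P D.Ac z
  simp only [sqWeight] at h2 ⊢
  linarith

/-- `‖·‖_P²` decreases along `z⁺ = Aᶜ z`, whose solutions tend to zero; hence it is nonnegative. -/
theorem sqWeight_P_nonneg (hD : D.Standing) (z : Fin n → ℝ) : 0 ≤ sqWeight D.P z := by
  have hle : ∀ k : ℕ, sqWeight D.P (D.Ac ^ k *ᵥ z) ≤ sqWeight D.P z := by
    intro k
    induction k with
    | zero => simp
    | succ k ih =>
      rw [pow_succ', ← Matrix.mulVec_mulVec, hD.sqWeight_P_mulVec]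
      have := hD.posDef_Q.sqWeight_nonneg (D.Ac ^ k *ᵥ z)
      linarith
  have hlim := ((continuous_sqWeight D.P).tendsto 0).comp (hD.schur.tendsto_pow_mulVec z)
  rw [sqWeight_zero] at hlim
  exact le_of_tendsto' hlim hle

/-! ### Geometry of the constraint set -/

theorem convex_Z (hD : D.Standing) : Convex ℝ D.Z := hD.polytope.convex

theorem isClosed_tightened (hD : D.Standing) : IsClosed ((1 - D.ε) • D.Z) :=
  hD.polytope.isClosed.smul_of_ne_zero (by have := hD.tightening_lt_one; linarith)

theorem convex_tightened (hD : D.Standing) : Convex ℝ ((1 - D.ε) • D.Z) := hD.convex_Z.smul _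

theorem smul_Z_mem_nhds (hD : D.Standing) : D.ε • D.Z ∈ 𝓝 (0 : Fin n ⊕ Fin m → ℝ) :=
  (set_smul_mem_nhds_zero_iff hD.tightening_pos.ne').mpr
    (mem_interior_iff_mem_nhds.mp hD.zero_mem_interior)

theorem add_mem_Z (hD : D.Standing) {a b : Fin n ⊕ Fin m → ℝ} (ha : a ∈ (1 - D.ε) • D.Z)
    (hb : b ∈ D.ε • D.Z) : a + b ∈ D.Z :=
  hD.convex_Z.add_mem_of_mem_smul hD.tightening_pos.le hD.tightening_lt_one.le ha hb

theorem tightened_subset (hD : D.Standing) {a : Fin n ⊕ Fin m → ℝ} (ha : a ∈ (1 - D.ε) • D.Z) :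
    a ∈ D.Z := by
  simpa using hD.add_mem_Z ha (mem_of_mem_nhds hD.smul_Z_mem_nhds)

end Standing

/-! ### The maximal constraint admissible set -/

/-- The state and input `(x(k), K x(k) + L w(k))` at time `k` under the nominal law `v = 0`,
written as a periodic regime plus a transient. -/
def response (D : MPCAgent n m q p N) (k : ℕ) (x : Fin n → ℝ) (w : Fin p → ℝ) :
    Fin n ⊕ Fin m → ℝ :=
  Sum.elim (D.Pi *ᵥ (D.S ^ k *ᵥ w) + D.Ac ^ k *ᵥ (x - D.Pi *ᵥ w))
    (D.Gam *ᵥ (D.S ^ k *ᵥ w) + D.K *ᵥ (D.Ac ^ k *ᵥ (x - D.Pi *ᵥ w)))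

theorem response_zero (D : MPCAgent n m q p N) (x : Fin n → ℝ) (w : Fin p → ℝ) :
    D.response 0 x w = Sum.elim x (D.K *ᵥ x + D.L *ᵥ w) := by
  simp only [response, pow_zero, Matrix.one_mulVec, L, Matrix.sub_mulVec, Matrix.mulVec_sub,
    ← Matrix.mulVec_mulVec]
  congr 1 <;> abel

/-- The regulator equation: the deviation from the regime `Pi w` evolves autonomously. -/
theorem Standing.regulator_step (hD : D.Standing) (x : Fin n → ℝ) (w : Fin p → ℝ) :
    D.Ac *ᵥ x + (D.B * D.L) *ᵥ w - D.Pi *ᵥ (D.S *ᵥ w) = D.Ac *ᵥ (x - D.Pi *ᵥ w) := by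
  rw [Matrix.mulVec_mulVec, ← hD.regulator_state]
  simp only [Ac, L, Matrix.add_mulVec, Matrix.mulVec_sub, Matrix.sub_mulVec, Matrix.mul_sub,
    ← Matrix.mulVec_mulVec]
  abel

theorem Standing.response_succ (hD : D.Standing) (k : ℕ) (x : Fin n → ℝ) (w : Fin p → ℝ) :
    D.response (k + 1) x w
      = D.response k (D.Ac *ᵥ x + (D.B * D.L) *ᵥ w) (D.S *ᵥ w) := by
  simp only [response, hD.regulator_step, Matrix.mulVec_mulVec _ (D.S ^ k),
    Matrix.mulVec_mulVec _ (D.Ac ^ k), ← pow_succ]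

theorem Standing.mem_admissible (hD : D.Standing) (k : ℕ) (x : Fin n → ℝ) (w : Fin p → ℝ) :
    (x, w) ∈ D.admissible k ↔ ∀ j ≤ k, D.response j x w ∈ (1 - D.ε) • D.Z := by
  induction k generalizing x w with
  | zero => simp [admissible, response_zero]
  | succ k ih =>
    simp only [admissible, Set.mem_ofPred_eq, ih, ← hD.response_succ, ← response_zero]
    constructor
    · rintro ⟨h0, h1⟩ (_ | j) hj
      · exact h0
      · exact h1 j (by omega)
    · exact fun h => ⟨h 0 (by omega), fun j hj => h (j + 1) (by omega)⟩

theorem Standing.mem_maxAdmissible (hD : D.Standing) (x : Fin n → ℝ) (w : Fin p → ℝ) :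
    (x, w) ∈ D.maxAdmissible ↔ ∀ k, D.response k x w ∈ (1 - D.ε) • D.Z := by
  simp only [maxAdmissible, Set.mem_iInter, hD.mem_admissible]
  exact ⟨fun h k => h k k le_rfl, fun h k j _ => h j⟩

theorem Standing.maxAdmissible_step (hD : D.Standing) {x : Fin n → ℝ} {w : Fin p → ℝ}
    (h : (x, w) ∈ D.maxAdmissible) :
    (D.Ac *ᵥ x + (D.B * D.L) *ᵥ w, D.S *ᵥ w) ∈ D.maxAdmissible := by
  rw [hD.mem_maxAdmissible] at h ⊢
  exact fun k => hD.response_succ k x w ▸ h (k + 1)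

theorem continuous_response (D : MPCAgent n m q p N) (k : ℕ) :
    Continuous fun xw : (Fin n → ℝ) × (Fin p → ℝ) => D.response k xw.1 xw.2 := by
  refine continuous_pi fun i => ?_
  rcases i with i | i <;> simp only [response, Sum.elim_inl, Sum.elim_inr]
  · exact (continuous_apply i).comp (by fun_prop)
  · exact (continuous_apply i).comp (by fun_prop)

theorem response_combo (D : MPCAgent n m q p N) (k : ℕ) (a b : ℝ) (x x' : Fin n → ℝ)
    (w w' : Fin p → ℝ) :
    D.response k (a • x + b • x') (a • w + b • w')
      = a • D.response k x w + b • D.response k x' w' := by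
  ext i
  rcases i with i | i <;>
  simp only [response, Matrix.mulVec_add, Matrix.mulVec_sub, Matrix.mulVec_smul, Sum.elim_inl,
    Sum.elim_inr, Pi.add_apply, Pi.sub_apply, Pi.smul_apply, smul_eq_mul] <;> ring

theorem Standing.isClosed_maxAdmissible (hD : D.Standing) : IsClosed D.maxAdmissible := by
  have : D.maxAdmissible = ⋂ k, {xw | D.response k xw.1 xw.2 ∈ (1 - D.ε) • D.Z} := by
    ext ⟨x, w⟩; simp [hD.mem_maxAdmissible]
  rw [this]
  exact isClosed_iInter fun k => hD.isClosed_tightened.preimage (D.continuous_response k)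

theorem Standing.convex_maxAdmissible (hD : D.Standing) : Convex ℝ D.maxAdmissible := by
  rintro ⟨x, w⟩ h ⟨x', w'⟩ h' a b ha hb hab
  rw [hD.mem_maxAdmissible] at h h'
  show (a • x + b • x', a • w + b • w') ∈ _
  rw [hD.mem_maxAdmissible]
  intro k
  rw [response_combo]
  exact hD.convex_tightened (h k) (h' k) ha hb hab

/-- The references whose periodic regime `(Pi Sᵏ w, Gam Sᵏ w)` satisfies the tightened
constraints, that is, those for which `(Pi w, w)` is in `O_∞`. -/
def steadyRefs (D : MPCAgent n m q p N) : Set (Fin p → ℝ) :=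
  {w | (D.Pi *ᵥ w, w) ∈ D.maxAdmissible}

theorem response_steady (D : MPCAgent n m q p N) (k : ℕ) (w : Fin p → ℝ) :
    D.response k (D.Pi *ᵥ w) w
      = Sum.elim (D.Pi *ᵥ (D.S ^ k *ᵥ w)) (D.Gam *ᵥ (D.S ^ k *ᵥ w)) := by
  simp [response]

theorem Standing.mem_steadyRefs (hD : D.Standing) (w : Fin p → ℝ) :
    w ∈ D.steadyRefs ↔ ∀ k,
      Sum.elim (D.Pi *ᵥ (D.S ^ k *ᵥ w)) (D.Gam *ᵥ (D.S ^ k *ᵥ w)) ∈ (1 - D.ε) • D.Z := by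
  simp only [steadyRefs, Set.mem_ofPred_eq, hD.mem_maxAdmissible, response_steady]

theorem Standing.convex_steadyRefs (hD : D.Standing) : Convex ℝ D.steadyRefs := by
  intro w h w' h' a b ha hb hab
  have := hD.convex_maxAdmissible h h' ha hb hab
  simpa only [steadyRefs, Set.mem_ofPred_eq, Matrix.mulVec_add, Matrix.mulVec_smul, Prod.smul_mk,
    Prod.mk_add_mk] using this

theorem Standing.pow_mul_period (hD : D.Standing) (i : ℕ) : D.S ^ (D.ρ * i) = 1 := by
  rw [pow_mul, hD.periodic, one_pow]

theorem Standing.pow_mem_steadyRefs (hD : D.Standing) (j : ℕ) {w : Fin p → ℝ} :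
    D.S ^ j *ᵥ w ∈ D.steadyRefs ↔ w ∈ D.steadyRefs := by
  simp only [hD.mem_steadyRefs, Matrix.mulVec_mulVec _ (D.S ^ _) (D.S ^ _), ← pow_add]
  refine ⟨fun h k => ?_, fun h k => h _⟩
  -- by periodicity, `Sᵏ = S^(k + (ρ - 1) j) Sʲ`
  have hk : k + (D.ρ - 1) * j + j = k + D.ρ * j := by
    obtain ⟨r, hr⟩ := Nat.exists_eq_add_of_le' hD.period_pos
    rw [hr, Nat.add_sub_cancel]; ring
  have := h (k + (D.ρ - 1) * j)
  rwa [hk, pow_add, hD.pow_mul_period, mul_one] at this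

/-- Along a period the transient of a response dies out, while the regime returns: a reference
that is admissible from some state is admissible in its periodic regime. -/
theorem Standing.mem_steadyRefs_of_maxAdmissible (hD : D.Standing) {x : Fin n → ℝ}
    {w : Fin p → ℝ} (h : (x, w) ∈ D.maxAdmissible) : w ∈ D.steadyRefs := by
  rw [hD.mem_maxAdmissible] at h
  rw [hD.mem_steadyRefs]
  intro k
  have hidx : Tendsto (fun i : ℕ => k + D.ρ * i) atTop atTop :=
    tendsto_atTop_mono
      (fun i => (Nat.le_mul_of_pos_left i hD.period_pos).trans (Nat.le_add_left _ k)) tendsto_id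
  have hz : Tendsto (fun i : ℕ => D.Ac ^ (k + D.ρ * i) *ᵥ (x - D.Pi *ᵥ w)) atTop (𝓝 0) :=
    (hD.schur.tendsto_pow_mulVec (x - D.Pi *ᵥ w)).comp hidx
  have hcont : Continuous fun z : Fin n → ℝ =>
      (Sum.elim (D.Pi *ᵥ (D.S ^ k *ᵥ w) + z) (D.Gam *ᵥ (D.S ^ k *ᵥ w) + D.K *ᵥ z) :
        Fin n ⊕ Fin m → ℝ) := by
    refine continuous_pi fun i => ?_
    rcases i with i | i <;> simp only [Sum.elim_inl, Sum.elim_inr]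
    · exact (continuous_apply i).comp (by fun_prop)
    · exact (continuous_apply i).comp (by fun_prop)
  have hlim := (hcont.tendsto 0).comp hz
  simp only [add_zero, Matrix.mulVec_zero] at hlim
  refine hD.isClosed_tightened.mem_of_tendsto hlim (Eventually.of_forall fun i => ?_)
  have := h (k + D.ρ * i)
  rwa [response, pow_add D.S, hD.pow_mul_period, mul_one] at this

end MPCAgent

/-! ### Existence and uniqueness of the optimal plan -/

namespace MPCAgent

variable {n m q p N : ℕ} {D : MPCAgent n m q p N}

/-- The predicted states generated from the decision variables `w̄(0)` and `v`; the control is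
taken to be zero past the horizon. -/
def rollout (D : MPCAgent n m q p N) (x : Fin n → ℝ) (w₀ : Fin p → ℝ) (v : Fin N → Fin m → ℝ) :
    ℕ → Fin n → ℝ
  | 0 => x
  | k + 1 => D.Ac *ᵥ D.rollout x w₀ v k + (D.B * D.L) *ᵥ (D.S ^ k *ᵥ w₀)
      + D.B *ᵥ (if h : k < N then v ⟨k, h⟩ else 0)

/-- The plan generated from the decision variables `w̄(0)` and `v`. -/
def planOf (D : MPCAgent n m q p N) (x : Fin n → ℝ) (wv : (Fin p → ℝ) × (Fin N → Fin m → ℝ)) :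
    MPCPlan n m p N where
  W k := D.S ^ (k : ℕ) *ᵥ wv.1
  V := wv.2
  X k := D.rollout x wv.1 wv.2 k

theorem continuous_rollout (D : MPCAgent n m q p N) (x : Fin n → ℝ) (k : ℕ) :
    Continuous fun wv : (Fin p → ℝ) × (Fin N → Fin m → ℝ) => D.rollout x wv.1 wv.2 k := by
  induction k with
  | zero => exact continuous_const
  | succ k ih =>
    simp only [rollout]
    by_cases h : k < N
    · simp only [h, dif_pos]; fun_prop
    · simp only [h, dif_neg, not_false_eq_true]; fun_prop

theorem IsFeasiblePlan.W_eq {x : Fin n → ℝ} {ξ : MPCPlan n m p N} (h : D.IsFeasiblePlan x ξ)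
    (k : Fin (N + 1)) : ξ.W k = D.S ^ (k : ℕ) *ᵥ ξ.W 0 := by
  induction k using Fin.induction with
  | zero => simp
  | succ k ih =>
    rw [h.dynamics_ref, ih, Matrix.mulVec_mulVec, Fin.val_succ, Fin.val_castSucc, pow_succ']

theorem IsFeasiblePlan.X_eq {x : Fin n → ℝ} {ξ : MPCPlan n m p N} (h : D.IsFeasiblePlan x ξ)
    (k : Fin (N + 1)) : ξ.X k = D.rollout x (ξ.W 0) ξ.V k := by
  induction k using Fin.induction with
  | zero => exact h.initial
  | succ k ih =>
    rw [h.dynamics_state, ih, h.W_eq k.castSucc]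
    simp [rollout]

theorem IsFeasiblePlan.eq_planOf {x : Fin n → ℝ} {ξ : MPCPlan n m p N}
    (h : D.IsFeasiblePlan x ξ) : ξ = D.planOf x (ξ.W 0, ξ.V) := by
  have hext : ∀ W X, ξ.W = W → ξ.X = X → ξ = ⟨W, ξ.V, X⟩ := by rintro _ _ rfl rfl; rfl
  exact hext _ _ (funext h.W_eq) (funext h.X_eq)

theorem isFeasiblePlan_planOf_iff (x : Fin n → ℝ) (wv : (Fin p → ℝ) × (Fin N → Fin m → ℝ)) :
    D.IsFeasiblePlan x (D.planOf x wv) ↔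
      (∀ k : Fin N, Sum.elim (D.rollout x wv.1 wv.2 k) (D.K *ᵥ D.rollout x wv.1 wv.2 k
        + D.L *ᵥ (D.S ^ (k : ℕ) *ᵥ wv.1) + wv.2 k) ∈ D.Z) ∧
      (D.rollout x wv.1 wv.2 N, D.S ^ N *ᵥ wv.1) ∈ D.maxAdmissible := by
  refine ⟨fun h => ⟨h.stage, h.terminal⟩, fun h => ⟨rfl, fun k => ?_, fun k => ?_, h.1, h.2⟩⟩
  · simp [planOf, rollout]
  · simp [planOf, pow_succ', Matrix.mulVec_mulVec]

theorem Standing.isClosed_feasible (hD : D.Standing) (x : Fin n → ℝ) :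
    IsClosed {wv | D.IsFeasiblePlan x (D.planOf x wv)} := by
  simp only [isFeasiblePlan_planOf_iff, Set.ofPred_and, Set.ofPred_forall]
  have hc := D.continuous_rollout x
  refine IsClosed.inter (isClosed_iInter fun k => hD.polytope.isClosed.preimage ?_)
    (hD.isClosed_maxAdmissible.preimage ?_)
  · have hck := hc k
    refine continuous_pi fun i => ?_
    rcases i with i | i <;> simp only [Sum.elim_inl, Sum.elim_inr]
    · exact (continuous_apply i).comp hck
    · exact (continuous_apply i).comp (by fun_prop)
  · have hcN := hc N
    fun_prop

theorem continuous_cost_planOf (D : MPCAgent n m q p N) (x : Fin n → ℝ) (w : Fin p → ℝ) :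
    Continuous fun wv => D.cost w (D.planOf x wv) := by
  have hc := D.continuous_rollout x
  simp only [cost, planOf]
  have h1 : ∀ k : Fin N, Continuous fun wv : (Fin p → ℝ) × (Fin N → Fin m → ℝ) =>
      sqWeight D.Q (D.rollout x wv.1 wv.2 k.castSucc
        - D.Pi *ᵥ (D.S ^ (k.castSucc : ℕ) *ᵥ wv.1)) := fun k => by
    have := hc k.castSucc
    fun_prop
  have h2 := hc (Fin.last N)
  have h3 := continuous_finsetSum Finset.univ fun k _ => h1 k
  fun_prop

/-- The part of the cost that depends on the decision variables `w̄(0)` and `v` only; it makes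
the cost coercive and strictly convex. -/
theorem Standing.le_cost (hD : D.Standing) (w : Fin p → ℝ) (ξ : MPCPlan n m p N) :
    sqWeight D.T (ξ.W 0 - w) + ∑ k, sqWeight D.R (ξ.V k) ≤ D.cost w ξ := by
  have h1 : 0 ≤ ∑ k : Fin N, sqWeight D.Q (ξ.X k.castSucc - D.Pi *ᵥ ξ.W k.castSucc) :=
    Finset.sum_nonneg fun _ _ => hD.posDef_Q.sqWeight_nonneg _
  have h2 := hD.sqWeight_P_nonneg (ξ.X (Fin.last N) - D.Pi *ᵥ ξ.W (Fin.last N))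
  unfold cost
  linarith

theorem Standing.sum_sqWeight_R_nonneg (hD : D.Standing) (V : Fin N → Fin m → ℝ) :
    0 ≤ ∑ k, sqWeight D.R (V k) := Finset.sum_nonneg fun _ _ => hD.posDef_R.sqWeight_nonneg _

theorem Standing.sqWeight_T_le_cost (hD : D.Standing) (w : Fin p → ℝ) (ξ : MPCPlan n m p N) :
    sqWeight D.T (ξ.W 0 - w) ≤ D.cost w ξ := by
  linarith [hD.le_cost w ξ, hD.sum_sqWeight_R_nonneg ξ.V]

theorem Standing.cost_nonneg (hD : D.Standing) (w : Fin p → ℝ) (ξ : MPCPlan n m p N) :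
    0 ≤ D.cost w ξ := (hD.sqWeight_T_nonneg _).trans (hD.sqWeight_T_le_cost w ξ)

theorem Standing.exists_mul_norm_sq_le_cost (hD : D.Standing) :
    ∃ c, 0 < c ∧ ∀ x w wv, c * ‖wv - (w, 0)‖ ^ 2 ≤ D.cost w (D.planOf x wv) := by
  obtain ⟨c, hc0, hc⟩ := exists_mul_norm_sq_le_of_homogeneous
    (f := fun wv : (Fin p → ℝ) × (Fin N → Fin m → ℝ) =>
      sqWeight D.T wv.1 + ∑ k, sqWeight D.R (wv.2 k)) (by fun_prop)
    (fun c wv => by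
      simp only [Prod.smul_fst, Prod.smul_snd, Pi.smul_apply, sqWeight_smul, mul_add,
        Finset.mul_sum])
    (fun wv hwv => by
      by_cases h : wv.1 = 0
      · have h2 : wv.2 ≠ 0 := fun h2 => hwv (Prod.ext h h2)
        obtain ⟨k, hk⟩ := Function.ne_iff.mp h2
        have := Finset.sum_pos' (s := Finset.univ) (f := fun k => sqWeight D.R (wv.2 k))
          (fun k _ => hD.posDef_R.sqWeight_nonneg _)
          ⟨k, Finset.mem_univ k, hD.posDef_R.sqWeight_pos hk⟩
        linarith [hD.sqWeight_T_nonneg wv.1]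
      · linarith [hD.sqWeight_T_pos h, hD.sum_sqWeight_R_nonneg wv.2])
  refine ⟨c, hc0, fun x w wv => (hc _).trans ?_⟩
  simpa [planOf] using hD.le_cost w (D.planOf x wv)

theorem Standing.exists_isOptimalPlan (hD : D.Standing) {x : Fin n → ℝ} (hx : D.Feasible x)
    (w : Fin p → ℝ) : ∃ ξ, D.IsOptimalPlan x w ξ := by
  obtain ⟨η, hη⟩ := hx
  have hη' := hη.eq_planOf
  obtain ⟨c, hc0, hc⟩ := hD.exists_mul_norm_sq_le_cost
  set s := {wv | D.IsFeasiblePlan x (D.planOf x wv)} ∩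
    {wv | D.cost w (D.planOf x wv) ≤ D.cost w η} with hs
  have hcl : IsClosed s := (hD.isClosed_feasible x).inter
    (isClosed_le (D.continuous_cost_planOf x w) continuous_const)
  have hbd : s ⊆ Metric.closedBall (w, 0) √(D.cost w η / c) := fun wv hwv => by
    rw [mem_closedBall_iff_norm]
    apply Real.le_sqrt_of_sq_le
    rw [le_div_iff₀ hc0, mul_comm]
    exact (hc x w wv).trans hwv.2
  have hK : IsCompact s := (isCompact_closedBall _ _).of_isClosed_subset hcl hbd
  have hmem : (η.W 0, η.V) ∈ s :=
    ⟨(hη' ▸ hη : D.IsFeasiblePlan x (D.planOf x (η.W 0, η.V))), (congrArg (D.cost w) hη').ge⟩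
  obtain ⟨a, ha, hmin⟩ := hK.exists_isMinOn ⟨_, hmem⟩ (D.continuous_cost_planOf x w).continuousOn
  refine ⟨_, ha.1, fun ζ hζ => ?_⟩
  rcases le_total (D.cost w ζ) (D.cost w η) with h | h
  · have hζ' := hζ.eq_planOf
    have : (ζ.W 0, ζ.V) ∈ s := ⟨(hζ' ▸ hζ : D.IsFeasiblePlan x (D.planOf x (ζ.W 0, ζ.V))),
      (congrArg (D.cost w) hζ').symm.trans_le h⟩
    exact (hmin this).trans (congrArg (D.cost w) hζ').ge
  · exact ha.2.trans h

/-- The midpoint of two plans. -/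
noncomputable def midplan (ξ η : MPCPlan n m p N) : MPCPlan n m p N where
  W k := (1 / 2 : ℝ) • (ξ.W k + η.W k)
  V k := (1 / 2 : ℝ) • (ξ.V k + η.V k)
  X k := (1 / 2 : ℝ) • (ξ.X k + η.X k)

theorem Standing.isFeasiblePlan_midplan (hD : D.Standing) {x : Fin n → ℝ}
    {ξ η : MPCPlan n m p N} (hξ : D.IsFeasiblePlan x ξ) (hη : D.IsFeasiblePlan x η) :
    D.IsFeasiblePlan x (midplan ξ η) where
  initial := by
    simp only [midplan, hξ.initial, hη.initial]
    rw [← two_smul ℝ x, smul_smul]; norm_num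
  dynamics_state k := by
    simp only [midplan, hξ.dynamics_state, hη.dynamics_state, Matrix.mulVec_smul,
      Matrix.mulVec_add, ← smul_add]
    congr 1; abel
  dynamics_ref k := by
    simp only [midplan, hξ.dynamics_ref, hη.dynamics_ref, Matrix.mulVec_smul, Matrix.mulVec_add]
  stage k := by
    have h := hD.convex_Z (hξ.stage k) (hη.stage k) (a := 1 / 2) (b := 1 / 2) (by norm_num)
      (by norm_num) (by norm_num)
    convert h using 1
    ext i
    rcases i with i | i <;>
    simp only [midplan, Matrix.mulVec_smul, Matrix.mulVec_add, Sum.elim_inl, Sum.elim_inr,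
      Pi.add_apply, Pi.smul_apply, smul_eq_mul] <;> ring
  terminal := by
    have h := hD.convex_maxAdmissible hξ.terminal hη.terminal (a := 1 / 2) (b := 1 / 2)
      (by norm_num) (by norm_num) (by norm_num)
    simpa only [midplan, smul_add, Prod.smul_mk, Prod.mk_add_mk] using h

theorem Standing.cost_midplan_le (hD : D.Standing) (w : Fin p → ℝ) (ξ η : MPCPlan n m p N) :
    D.cost w (midplan ξ η) ≤ (D.cost w ξ + D.cost w η) / 2
      - (sqWeight D.T (ξ.W 0 - η.W 0) + ∑ k, sqWeight D.R (ξ.V k - η.V k)) / 4 := by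
  have hT : (midplan ξ η).W 0 - w = (1 / 2 : ℝ) • ((ξ.W 0 - w) + (η.W 0 - w)) := by
    ext i; simp only [midplan, Pi.sub_apply, Pi.smul_apply, Pi.add_apply, smul_eq_mul]; ring
  have hX : ∀ k, (midplan ξ η).X k - D.Pi *ᵥ (midplan ξ η).W k
      = (1 / 2 : ℝ) • ((ξ.X k - D.Pi *ᵥ ξ.W k) + (η.X k - D.Pi *ᵥ η.W k)) := fun k => by
    ext i
    simp only [midplan, Matrix.mulVec_smul, Matrix.mulVec_add, Pi.sub_apply, Pi.smul_apply,
      Pi.add_apply, smul_eq_mul]; ring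
  have hV : ∀ k, (midplan ξ η).V k = (1 / 2 : ℝ) • (ξ.V k + η.V k) := fun _ => rfl
  have hQ := Finset.sum_nonneg fun (k : Fin N) (_ : k ∈ Finset.univ) =>
    hD.posDef_Q.sqWeight_nonneg
      ((ξ.X k.castSucc - D.Pi *ᵥ ξ.W k.castSucc) - (η.X k.castSucc - D.Pi *ᵥ η.W k.castSucc))
  have hP := hD.sqWeight_P_nonneg ((ξ.X (Fin.last N) - D.Pi *ᵥ ξ.W (Fin.last N))
    - (η.X (Fin.last N) - D.Pi *ᵥ η.W (Fin.last N)))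
  simp only [cost, hT, hX, hV, sqWeight_midpoint, sub_sub_sub_cancel_right,
    Finset.sum_sub_distrib, Finset.sum_add_distrib, ← Finset.sum_div]
  linarith

theorem Standing.isOptimalPlan_unique (hD : D.Standing) {x : Fin n → ℝ} {w : Fin p → ℝ}
    {ξ η : MPCPlan n m p N} (hξ : D.IsOptimalPlan x w ξ) (hη : D.IsOptimalPlan x w η) :
    ξ = η := by
  have h1 := hξ.2 _ (hD.isFeasiblePlan_midplan hξ.1 hη.1)
  have h2 := hD.cost_midplan_le w ξ η
  have h3 := hη.2 _ hξ.1
  have h3' := hξ.2 _ hη.1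
  have h4 := hD.sqWeight_T_nonneg (ξ.W 0 - η.W 0)
  have h5 := hD.sum_sqWeight_R_nonneg fun k => ξ.V k - η.V k
  have hW : ξ.W 0 = η.W 0 := by
    by_contra hne
    linarith [hD.sqWeight_T_pos (sub_ne_zero.mpr hne)]
  have hV : ξ.V = η.V := by
    funext k
    have h6 := Finset.single_le_sum (f := fun k => sqWeight D.R (ξ.V k - η.V k))
      (fun k _ => hD.posDef_R.sqWeight_nonneg _) (Finset.mem_univ k)
    exact sub_eq_zero.mp (hD.posDef_R.eq_zero_of_sqWeight_nonpos (by linarith))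
  rw [hξ.1.eq_planOf, hη.1.eq_planOf, hW, hV]

theorem Standing.existsUnique_isOptimalPlan (hD : D.Standing) {x : Fin n → ℝ}
    (hx : D.Feasible x) (w : Fin p → ℝ) : ∃! ξ, D.IsOptimalPlan x w ξ := by
  obtain ⟨ξ, hξ⟩ := hD.exists_isOptimalPlan hx w
  exact ⟨ξ, hξ, fun η hη => hD.isOptimalPlan_unique hη hξ⟩

theorem Standing.isOptimalPlan_optimalPlan (hD : D.Standing) {x : Fin n → ℝ}
    (hx : D.Feasible x) (w : Fin p → ℝ) : D.IsOptimalPlan x w (D.optimalPlan x w) :=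
  Classical.epsilon_spec (hD.exists_isOptimalPlan hx w)

end MPCAgent

/-! ### The shifted plan and recursive feasibility -/

namespace MPCAgent

variable {n m q p N : ℕ}

/-- The tail of a plan, prolonged by one step of the nominal law `v = 0`. -/
def shiftPlan (D : MPCAgent n m q p (N + 1)) (ξ : MPCPlan n m p (N + 1)) :
    MPCPlan n m p (N + 1) where
  W k := D.S *ᵥ ξ.W k
  V := Fin.snoc (fun k : Fin N => ξ.V k.succ) 0
  X := Fin.snoc (fun k : Fin (N + 1) => ξ.X k.succ)
    (D.Ac *ᵥ ξ.X (Fin.last (N + 1)) + (D.B * D.L) *ᵥ ξ.W (Fin.last (N + 1)))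

variable {D : MPCAgent n m q p (N + 1)}

theorem shiftPlan_X_castSucc (ξ : MPCPlan n m p (N + 1)) (k : Fin (N + 1)) :
    (D.shiftPlan ξ).X k.castSucc = ξ.X k.succ := by simp [shiftPlan]

theorem shiftPlan_X_last (ξ : MPCPlan n m p (N + 1)) :
    (D.shiftPlan ξ).X (Fin.last (N + 1))
      = D.Ac *ᵥ ξ.X (Fin.last (N + 1)) + (D.B * D.L) *ᵥ ξ.W (Fin.last (N + 1)) := by
  simp [shiftPlan]

theorem shiftPlan_V_castSucc (ξ : MPCPlan n m p (N + 1)) (k : Fin N) :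
    (D.shiftPlan ξ).V k.castSucc = ξ.V k.succ := by simp [shiftPlan]

theorem shiftPlan_V_last (ξ : MPCPlan n m p (N + 1)) :
    (D.shiftPlan ξ).V (Fin.last N) = 0 := by simp [shiftPlan]

theorem IsFeasiblePlan.shiftPlan_W_castSucc {x : Fin n → ℝ} {ξ : MPCPlan n m p (N + 1)}
    (h : D.IsFeasiblePlan x ξ) (k : Fin (N + 1)) :
    (D.shiftPlan ξ).W k.castSucc = ξ.W k.succ := (h.dynamics_ref k).symm

theorem Standing.isFeasiblePlan_shiftPlan (hD : D.Standing) {x : Fin n → ℝ}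
    {ξ : MPCPlan n m p (N + 1)} (h : D.IsFeasiblePlan x ξ) :
    D.IsFeasiblePlan (ξ.X 1) (D.shiftPlan ξ) where
  initial := shiftPlan_X_castSucc ξ 0
  dynamics_state k := by
    rw [shiftPlan_X_castSucc, h.shiftPlan_W_castSucc]
    induction k using Fin.lastCases with
    | last => rw [Fin.succ_last, shiftPlan_X_last, shiftPlan_V_last, Matrix.mulVec_zero, add_zero]
    | cast k =>
      rw [← Fin.castSucc_succ, shiftPlan_X_castSucc, shiftPlan_V_castSucc, h.dynamics_state k.succ,
        Fin.castSucc_succ]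
  dynamics_ref k := by
    simp only [shiftPlan, h.dynamics_ref k]
  stage k := by
    rw [shiftPlan_X_castSucc, h.shiftPlan_W_castSucc]
    induction k using Fin.lastCases with
    | last =>
      rw [Fin.succ_last, shiftPlan_V_last, add_zero, ← response_zero]
      exact hD.tightened_subset ((hD.mem_maxAdmissible _ _).mp h.terminal 0)
    | cast k =>
      rw [shiftPlan_V_castSucc, ← Fin.castSucc_succ]
      exact h.stage k.succ
  terminal := by
    rw [shiftPlan_X_last]
    exact hD.maxAdmissible_step h.terminal

/-- If the reference follows the exosystem, shifting a plan saves exactly its first stage cost. -/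
theorem Standing.cost_shiftPlan (hD : D.Standing) {x : Fin n → ℝ} (w : Fin p → ℝ)
    {ξ : MPCPlan n m p (N + 1)} (h : D.IsFeasiblePlan x ξ) :
    D.cost (D.S *ᵥ w) (D.shiftPlan ξ)
      = D.cost w ξ - sqWeight D.Q (ξ.X 0 - D.Pi *ᵥ ξ.W 0) - sqWeight D.R (ξ.V 0) := by
  have hT : sqWeight D.T ((D.shiftPlan ξ).W 0 - D.S *ᵥ w) = sqWeight D.T (ξ.W 0 - w) := by
    rw [← hD.sqWeight_T_mulVec (ξ.W 0 - w), Matrix.mulVec_sub]; rfl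
  have hP : sqWeight D.P ((D.shiftPlan ξ).X (Fin.last _)
        - D.Pi *ᵥ (D.shiftPlan ξ).W (Fin.last _))
      = sqWeight D.P (ξ.X (Fin.last _) - D.Pi *ᵥ ξ.W (Fin.last _))
        - sqWeight D.Q (ξ.X (Fin.last _) - D.Pi *ᵥ ξ.W (Fin.last _)) := by
    rw [← hD.sqWeight_P_mulVec, shiftPlan_X_last, ← hD.regulator_step]; rfl
  have hR : ∑ k, sqWeight D.R ((D.shiftPlan ξ).V k)
      = ∑ k, sqWeight D.R (ξ.V k) - sqWeight D.R (ξ.V 0) := by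
    rw [Fin.sum_univ_castSucc, Fin.sum_univ_succ (fun k => sqWeight D.R (ξ.V k))]
    simp only [shiftPlan_V_castSucc, shiftPlan_V_last, sqWeight_zero]
    ring
  have hQ : ∑ k : Fin (N + 1), sqWeight D.Q ((D.shiftPlan ξ).X k.castSucc
        - D.Pi *ᵥ (D.shiftPlan ξ).W k.castSucc)
      = ∑ k : Fin (N + 1), sqWeight D.Q (ξ.X k.castSucc - D.Pi *ᵥ ξ.W k.castSucc)
        - sqWeight D.Q (ξ.X 0 - D.Pi *ᵥ ξ.W 0)
        + sqWeight D.Q (ξ.X (Fin.last _) - D.Pi *ᵥ ξ.W (Fin.last _)) := by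
    simp only [shiftPlan_X_castSucc, h.shiftPlan_W_castSucc]
    have h1 := Fin.sum_univ_castSucc fun k => sqWeight D.Q (ξ.X k - D.Pi *ᵥ ξ.W k)
    rw [Fin.sum_univ_succ] at h1
    linarith
  rw [cost, hT, hP, hR, hQ, cost]
  ring

end MPCAgent

/-! ### Deadbeat control -/

theorem IsControllablePair.surjective_mulVecLin {n m : ℕ} {A : Matrix (Fin n) (Fin n) ℝ}
    {B : Matrix (Fin n) (Fin m) ℝ} (h : IsControllablePair A B) :
    Function.Surjective (Matrix.of fun (i : Fin n) (kj : Fin n × Fin m) =>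
      (A ^ (kj.1 : ℕ) * B) i kj.2).mulVecLin := by
  rw [← LinearMap.range_eq_top]
  refine Submodule.eq_top_of_finrank_eq ?_
  rw [Module.finrank_fin_fun]
  exact h

/-- A controllable pair can be steered to the origin in any `N ≥ n` steps, by inputs and along
states that depend linearly on the initial state. -/
theorem IsControllablePair.exists_deadbeat {n m N : ℕ} {A : Matrix (Fin n) (Fin n) ℝ}
    {B : Matrix (Fin n) (Fin m) ℝ} (h : IsControllablePair A B) (hN : n ≤ N) :
    ∃ (Φ : ℕ → (Fin n → ℝ) →ₗ[ℝ] (Fin n → ℝ)) (μ : ℕ → (Fin n → ℝ) →ₗ[ℝ] (Fin m → ℝ)),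
      (∀ z, Φ 0 z = z) ∧ (∀ k z, Φ (k + 1) z = A *ᵥ Φ k z + B *ᵥ μ k z) ∧ ∀ z, Φ N z = 0 := by
  obtain ⟨g, hg⟩ := LinearMap.exists_rightInverse_of_surjective _
    (LinearMap.range_eq_top.mpr h.surjective_mulVecLin)
  -- the coefficient of `A ^ j * B` in a Kalman-matrix representation of `-A ^ N z`
  let c : ℕ → (Fin n → ℝ) →ₗ[ℝ] (Fin m → ℝ) := fun j =>
    if hj : j < n then LinearMap.pi fun i =>
      LinearMap.proj ((⟨j, hj⟩ : Fin n), i) ∘ₗ g ∘ₗ (-(A ^ N).mulVecLin) else 0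
  have hc : ∀ z, ∑ j ∈ Finset.range N, (A ^ j * B) *ᵥ c j z = -(A ^ N *ᵥ z) := by
    intro z
    have h1 : ∑ j ∈ Finset.range n, (A ^ j * B) *ᵥ c j z
        = ∑ j ∈ Finset.range N, (A ^ j * B) *ᵥ c j z :=
      Finset.sum_subset (Finset.range_mono hN) fun j _ hj => by
        rw [Finset.mem_range] at hj
        simp [c, hj]
    rw [← h1, ← Fin.sum_univ_eq_sum_range (fun j => (A ^ j * B) *ᵥ c j z)]
    have h2 := LinearMap.congr_fun hg (-(A ^ N *ᵥ z))
    rw [LinearMap.comp_apply, LinearMap.id_apply] at h2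
    rw [← h2]
    ext i
    simp only [Finset.sum_apply, Matrix.mulVecLin_apply, Matrix.mulVec, dotProduct,
      Fintype.sum_prod_type, Matrix.of_apply]
    refine Finset.sum_congr rfl fun j _ => Finset.sum_congr rfl fun l _ => ?_
    simp [c]
  let Φ : ℕ → (Fin n → ℝ) →ₗ[ℝ] (Fin n → ℝ) := fun k => (A ^ k).mulVecLin
    + ∑ i ∈ Finset.range k, (A ^ (k - 1 - i) * B).mulVecLin ∘ₗ c (N - 1 - i)
  have hΦ : ∀ k z, Φ k z = A ^ k *ᵥ z
      + ∑ i ∈ Finset.range k, (A ^ (k - 1 - i) * B) *ᵥ c (N - 1 - i) z := fun k z => by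
    simp [Φ, LinearMap.sum_apply]
  refine ⟨Φ, fun k => c (N - 1 - k), fun z => by simp [hΦ], fun k z => ?_, fun z => ?_⟩
  · rw [hΦ, hΦ, Finset.sum_range_succ, Matrix.mulVec_add, Matrix.mulVec_sum,
      Matrix.mulVec_mulVec, ← pow_succ', ← add_assoc]
    congr 1
    · congr 1
      refine Finset.sum_congr rfl fun i hi => ?_
      rw [Finset.mem_range] at hi
      rw [Matrix.mulVec_mulVec, ← Matrix.mul_assoc, ← pow_succ',
        show k + 1 - 1 - i = k - 1 - i + 1 by omega]
    · simp
  · rw [hΦ, Finset.sum_range_reflect (fun j => (A ^ j * B) *ᵥ c j z), hc, add_neg_cancel]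

/-! ### Moving the artificial reference -/

theorem tendsto_zero_of_mul_norm_sq_le {ι E : Type*} [SeminormedAddCommGroup E] {l : Filter ι}
    {z : ι → E} {f : ι → ℝ} {c : ℝ} (hc : 0 < c) (h : ∀ i, c * ‖z i‖ ^ 2 ≤ f i)
    (hf : Tendsto f l (𝓝 0)) : Tendsto z l (𝓝 0) := by
  have h1 : Tendsto (fun i => √(f i / c)) l (𝓝 0) := by
    simpa using (hf.div_const c).sqrt
  refine squeeze_zero_norm (fun i => Real.le_sqrt_of_sq_le ?_) h1
  rw [le_div_iff₀ hc, mul_comm]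
  exact h i

namespace MPCAgent

variable {n m q p N : ℕ} {D : MPCAgent n m q p N}

/-- A reference in `steadyRefs` can be used as artificial reference from every state near its
regime: a deadbeat input joins the regime within the horizon, so that the terminal constraint
holds exactly, and the tightening absorbs the deviation. The cost is quadratic in the deviation. -/
theorem Standing.exists_steering (hD : D.Standing) (hN : n ≤ N) :
    ∃ C, 0 ≤ C ∧ ∃ r, 0 < r ∧ ∀ x w w', w' ∈ D.steadyRefs → ‖x - D.Pi *ᵥ w'‖ < r →
      ∃ ξ, D.IsFeasiblePlan x ξ ∧
        D.cost w ξ ≤ sqWeight D.T (w' - w) + C * ‖x - D.Pi *ᵥ w'‖ ^ 2 := by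
  obtain ⟨Φ, μ, hΦ0, hΦs, hΦN⟩ := hD.controllable.exists_deadbeat hN
  have hΦc : ∀ k, Continuous fun z => Φ k z := fun k => (Φ k).continuous_of_finiteDimensional
  have hμc : ∀ k, Continuous fun z => μ k z := fun k => (μ k).continuous_of_finiteDimensional
  obtain ⟨C, hC0, hC⟩ := exists_le_mul_norm_sq_of_homogeneous
    (f := fun z => ∑ k : Fin N, sqWeight D.Q (Φ k z)
      + ∑ k : Fin N, sqWeight D.R (μ k z - D.K *ᵥ Φ k z))
    (by fun_prop)
    (fun c z => by
      simp only [map_smul, Matrix.mulVec_smul, ← smul_sub, sqWeight_smul, mul_add,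
        Finset.mul_sum])
  have hnear : ∀ᶠ z in 𝓝 (0 : Fin n → ℝ), ∀ k : Fin N,
      (Sum.elim (Φ k z) (μ k z) : Fin n ⊕ Fin m → ℝ) ∈ D.ε • D.Z := by
    refine eventually_all.mpr fun k => ?_
    have hcont : Continuous fun z => (Sum.elim (Φ k z) (μ k z) : Fin n ⊕ Fin m → ℝ) := by
      refine continuous_pi fun i => ?_
      rcases i with i | i <;> simp only [Sum.elim_inl, Sum.elim_inr]
      · exact (continuous_apply i).comp (hΦc k)
      · exact (continuous_apply i).comp (hμc k)
    refine hcont.continuousAt.eventually_mem ?_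
    have h0 : (Sum.elim (Φ k 0) (μ k 0) : Fin n ⊕ Fin m → ℝ) = 0 := by
      ext i; rcases i with i | i <;> simp
    rw [h0]
    exact hD.smul_Z_mem_nhds
  obtain ⟨r, hr0, hr⟩ := Metric.eventually_nhds_iff.mp hnear
  refine ⟨C, hC0, r, hr0, fun x w w' hw' hx => ?_⟩
  set z := x - D.Pi *ᵥ w' with hz
  let ξ : MPCPlan n m p N :=
    { W := fun k => D.S ^ (k : ℕ) *ᵥ w'
      V := fun k => μ k z - D.K *ᵥ Φ k z
      X := fun k => D.Pi *ᵥ (D.S ^ (k : ℕ) *ᵥ w') + Φ k z }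
  have hin : ∀ k : Fin N, D.K *ᵥ ξ.X k.castSucc + D.L *ᵥ ξ.W k.castSucc + ξ.V k
      = D.Gam *ᵥ (D.S ^ (k : ℕ) *ᵥ w') + μ k z := fun k => by
    simp only [ξ, L, Fin.val_castSucc, Matrix.mulVec_add, Matrix.sub_mulVec,
      ← Matrix.mulVec_mulVec]
    abel
  refine ⟨ξ, ⟨?_, fun k => ?_, fun k => ?_, fun k => ?_, ?_⟩, ?_⟩
  · simp [ξ, hΦ0, hz]
  · have h1 := hD.regulator_step (ξ.X k.castSucc) (ξ.W k.castSucc)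
    rw [sub_eq_iff_eq_add] at h1
    rw [h1]
    simp only [ξ, Fin.val_castSucc, Fin.val_succ, hΦs, add_sub_cancel_left, Ac,
      Matrix.add_mulVec, Matrix.mulVec_sub, Matrix.mulVec_mulVec, pow_succ']
    abel
  · simp only [ξ, Fin.val_castSucc, Fin.val_succ, Matrix.mulVec_mulVec, pow_succ']
  · rw [hin]
    have h1 := hD.add_mem_Z ((hD.mem_steadyRefs w').mp hw' k) (hr (by simpa using hx) k)
    convert h1 using 1
    ext i
    rcases i with i | i <;> simp [ξ]
  · have h1 : ξ.X (Fin.last N) = D.Pi *ᵥ ξ.W (Fin.last N) := by simp [ξ, hΦN]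
    rw [h1]
    exact (hD.pow_mem_steadyRefs N).mpr hw'
  · have h1 := hC z
    simp only [cost, ξ, add_sub_cancel_left, Fin.val_castSucc, Fin.val_last, hΦN, sqWeight_zero,
      Fin.val_zero, pow_zero, Matrix.one_mulVec]
    linarith

theorem IsFeasiblePlan.W_zero_mem_steadyRefs (hD : D.Standing) {x : Fin n → ℝ}
    {ξ : MPCPlan n m p N} (h : D.IsFeasiblePlan x ξ) : ξ.W 0 ∈ D.steadyRefs := by
  have h1 := hD.mem_steadyRefs_of_maxAdmissible h.terminal
  rwa [h.W_eq, hD.pow_mem_steadyRefs] at h1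

/-- The offset `‖w̄(0) - w‖_T²` of an optimal artificial reference is controlled by the distance
of the state from the artificial regime: otherwise moving `w̄(0)` towards `w` would pay off. -/
theorem Standing.exists_offset_le (hD : D.Standing) (hN : n ≤ N) (J : ℝ) :
    ∃ C η, 0 < η ∧ ∀ x w ξ, D.IsOptimalPlan x w ξ → w ∈ D.steadyRefs → D.cost w ξ ≤ J →
      ‖x - D.Pi *ᵥ ξ.W 0‖ < η →
        sqWeight D.T (ξ.W 0 - w) ≤ C * ‖x - D.Pi *ᵥ ξ.W 0‖ ^ 2 := by
  obtain ⟨C, hC0, r, hr0, hsteer⟩ := hD.exists_steering hN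
  obtain ⟨c, hc0, hc⟩ := exists_mul_norm_sq_le_sqWeight (M := D.T) fun w hw => hD.sqWeight_T_pos hw
  obtain ⟨C', hC'0, hC'⟩ := exists_le_mul_norm_sq_of_homogeneous
    (f := fun w : Fin p → ℝ => ‖D.Pi *ᵥ w‖ ^ 2) (by fun_prop)
    (fun a w => by rw [Matrix.mulVec_smul, norm_smul, mul_pow, Real.norm_eq_abs, sq_abs])
  have hPi : ∀ w, ‖D.Pi *ᵥ w‖ ^ 2 ≤ C' / c * sqWeight D.T w := fun w => by
    rw [div_mul_eq_mul_div, le_div_iff₀ hc0]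
    nlinarith [hC' w, hc w]
  set C₂ := C' / c with hC₂
  have hC₂0 : 0 ≤ C₂ := div_nonneg hC'0 hc0.le
  -- the step `lam` towards `w` must leave the deviation from the new regime below `r` and make
  -- the gain, of first order in `lam`, dominate the second-order cost of the transfer
  obtain ⟨lam, ⟨hl1, hl2⟩, hl0⟩ : ∃ lam : ℝ,
      (lam * (1 + 2 * C * C₂) < 1 ∧ lam ^ 2 * (C₂ * J) < (r / 2) ^ 2) ∧ 0 < lam := by
    have h1 : ∀ᶠ lam : ℝ in 𝓝 0, lam * (1 + 2 * C * C₂) < 1 :=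
      (by fun_prop : Continuous fun lam : ℝ =>
        lam * (1 + 2 * C * C₂)).continuousAt.eventually_lt_const (by norm_num)
    have h2 : ∀ᶠ lam : ℝ in 𝓝 0, lam ^ 2 * (C₂ * J) < (r / 2) ^ 2 :=
      (by fun_prop : Continuous fun lam : ℝ =>
        lam ^ 2 * (C₂ * J)).continuousAt.eventually_lt_const
        (by simpa using pow_pos (half_pos hr0) 2)
    exact (((h1.and h2).filter_mono nhdsWithin_le_nhds).and
      (self_mem_nhdsWithin : Set.Ioi (0 : ℝ) ∈ 𝓝[>] 0)).exists
  have hl1' : lam ≤ 1 := by nlinarith [mul_nonneg (mul_nonneg hl0.le hC0) hC₂0]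
  refine ⟨2 * C / lam, r / 2, half_pos hr0, fun x w ξ hξ hw hJ hδ => ?_⟩
  set δ := x - D.Pi *ᵥ ξ.W 0 with hδd
  set τ := sqWeight D.T (ξ.W 0 - w) with hτ
  have hτcost : τ ≤ D.cost w ξ := hD.sqWeight_T_le_cost w ξ
  have hτ0 : 0 ≤ τ := hD.sqWeight_T_nonneg _
  set w' := (1 - lam) • ξ.W 0 + lam • w with hw'd
  have hw' : w' ∈ D.steadyRefs := hD.convex_steadyRefs
    (IsFeasiblePlan.W_zero_mem_steadyRefs hD hξ.1) hw (by linarith) hl0.le (by ring)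
  have hx' : x - D.Pi *ᵥ w' = δ + lam • (D.Pi *ᵥ (ξ.W 0 - w)) := by
    ext i
    simp only [hw'd, hδd, Matrix.mulVec_add, Matrix.mulVec_sub, Matrix.mulVec_smul, Pi.sub_apply,
      Pi.add_apply, Pi.smul_apply, smul_eq_mul]
    ring
  have hww' : w' - w = (1 - lam) • (ξ.W 0 - w) := by
    ext i
    simp only [hw'd, Pi.sub_apply, Pi.add_apply, Pi.smul_apply, smul_eq_mul]
    ring
  have hnorm : ‖x - D.Pi *ᵥ w'‖ ≤ ‖δ‖ + lam * ‖D.Pi *ᵥ (ξ.W 0 - w)‖ := by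
    rw [hx']
    refine (norm_add_le _ _).trans_eq ?_
    rw [norm_smul, Real.norm_of_nonneg hl0.le]
  have hs := hPi (ξ.W 0 - w)
  set σ := ‖D.Pi *ᵥ (ξ.W 0 - w)‖ with hσ
  have hσ0 : 0 ≤ σ := norm_nonneg _
  have hlσ : lam * σ < r / 2 := by
    refine lt_of_pow_lt_pow_left₀ 2 (half_pos hr0).le (lt_of_le_of_lt ?_ hl2)
    rw [mul_pow]
    exact mul_le_mul_of_nonneg_left
      (hs.trans (mul_le_mul_of_nonneg_left (hτcost.trans hJ) hC₂0)) (sq_nonneg _)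
  obtain ⟨ζ, hζ, hζc⟩ := hsteer x w w' hw' (by linarith)
  have hsq : ‖x - D.Pi *ᵥ w'‖ ^ 2 ≤ 2 * ‖δ‖ ^ 2 + 2 * (lam ^ 2 * (C₂ * τ)) := by
    have h1 := pow_le_pow_left₀ (norm_nonneg _) hnorm 2
    have h2 := mul_le_mul_of_nonneg_left hs (sq_nonneg lam)
    nlinarith [sq_nonneg (‖δ‖ - lam * σ)]
  have hkey : τ ≤ (1 - lam) ^ 2 * τ + C * (2 * ‖δ‖ ^ 2 + 2 * (lam ^ 2 * (C₂ * τ))) := by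
    have h1 := hξ.2 ζ hζ
    rw [hww', sqWeight_smul] at hζc
    have h2 := mul_le_mul_of_nonneg_left hsq hC0
    linarith
  rw [div_mul_eq_mul_div, le_div_iff₀ hl0]
  have h1 : lam * τ * (lam * (1 + 2 * C * C₂)) ≤ lam * τ * 1 :=
    mul_le_mul_of_nonneg_left hl1.le (mul_nonneg hl0.le hτ0)
  linarith

/-! ### The closed loop -/

variable [NeZero N]

/-- One step of the closed loop: the successor state is the second state of the optimal plan. -/
theorem IsOptimalPlan.next_eq {x : Fin n → ℝ} {w : Fin p → ℝ} {ξ : MPCPlan n m p N}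
    (h : D.IsOptimalPlan x w ξ) :
    D.A *ᵥ x + D.B *ᵥ (D.K *ᵥ x + D.L *ᵥ ξ.W 0 + ξ.V 0) = ξ.X 1 := by
  obtain ⟨N, rfl⟩ := Nat.exists_eq_succ_of_ne_zero (NeZero.ne N)
  have h1 := h.1.dynamics_state 0
  rw [Fin.castSucc_zero, h.1.initial] at h1
  refine Eq.trans ?_ h1.symm
  simp only [Ac, Matrix.add_mulVec, Matrix.mulVec_add, ← Matrix.mulVec_mulVec]
  abel

theorem IsFeasiblePlan.stage_zero {x : Fin n → ℝ} {ξ : MPCPlan n m p N}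
    (h : D.IsFeasiblePlan x ξ) :
    Sum.elim x (D.K *ᵥ x + D.L *ᵥ ξ.W 0 + ξ.V 0) ∈ D.Z := by
  obtain ⟨N, rfl⟩ := Nat.exists_eq_succ_of_ne_zero (NeZero.ne N)
  have h1 := h.stage 0
  rwa [Fin.castSucc_zero, h.initial] at h1

/-- The tail of a feasible plan witnesses recursive feasibility and, when the reference follows
the exosystem, the decrease of the cost. -/
theorem Standing.exists_successor_plan (hD : D.Standing) {x : Fin n → ℝ} (w : Fin p → ℝ)
    {ξ : MPCPlan n m p N} (h : D.IsFeasiblePlan x ξ) :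
    ∃ η, D.IsFeasiblePlan (ξ.X 1) η ∧
      D.cost (D.S *ᵥ w) η + sqWeight D.Q (x - D.Pi *ᵥ ξ.W 0) ≤ D.cost w ξ := by
  obtain ⟨N, rfl⟩ := Nat.exists_eq_succ_of_ne_zero (NeZero.ne N)
  refine ⟨D.shiftPlan ξ, hD.isFeasiblePlan_shiftPlan h, ?_⟩
  rw [hD.cost_shiftPlan w h, h.initial]
  linarith [hD.posDef_R.sqWeight_nonneg (ξ.V 0)]

end MPCAgent

theorem mainTheorem2 {n m q p N : ℕ} [NeZero N] (D : MPCAgent n m q p N) (hD : D.Standing)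
    (hN : n ≤ N)
    -- closed-loop state, input and an arbitrary (possibly switching) reference from time `t` on
    (x : ℕ → Fin n → ℝ) (u : ℕ → Fin m → ℝ) (w : ℕ → Fin p → ℝ) (t : ℕ)
    (hx : ∀ s, t ≤ s → x (s + 1) = D.A *ᵥ x s + D.B *ᵥ u s)
    (hu : ∀ s, t ≤ s → u s = D.control (x s) (w s))
    (hfeas : D.Feasible (x t)) :
    -- the controller is well defined
    (∀ s, t ≤ s → ∃! ξ, D.IsOptimalPlan (x s) (w s) ξ) ∧
    -- constraint satisfaction
    (∀ s, t ≤ s → Sum.elim (x s) (u s) ∈ D.Z) ∧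
    -- recursive feasibility
    (∀ s, t ≤ s → D.Feasible (x (s + 1))) ∧
    -- convergence of the tracking error
    ((∀ s, t ≤ s → w (s + 1) = D.S *ᵥ w s) → w t ∈ D.admissibleRefs →
      Tendsto (fun s => D.trackingError (x s) (w s)) atTop (𝓝 0)) := by
  have hstep : ∀ s, t ≤ s → D.Feasible (x s) →
      x (s + 1) = (D.optimalPlan (x s) (w s)).X 1 := fun s hs hf => by
    rw [hx s hs, hu s hs]
    exact (hD.isOptimalPlan_optimalPlan hf (w s)).next_eq
  have hall : ∀ s, t ≤ s → D.Feasible (x s) := by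
    intro s hs
    induction s, hs using Nat.le_induction with
    | base => exact hfeas
    | succ s hs ih =>
      obtain ⟨η, hη, -⟩ := hD.exists_successor_plan (w s)
        (hD.isOptimalPlan_optimalPlan ih (w s)).1
      rw [hstep s hs ih]
      exact ⟨η, hη⟩
  refine ⟨fun s hs => hD.existsUnique_isOptimalPlan (hall s hs) (w s), fun s hs => ?_,
    fun s hs => hall (s + 1) (by omega), fun hw hwt => ?_⟩
  · rw [hu s hs]
    exact (hD.isOptimalPlan_optimalPlan (hall s hs) (w s)).1.stage_zero
  -- time is counted from `t` on, as nothing is assumed about the loop before `t`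
  set ξ := fun i => D.optimalPlan (x (t + i)) (w (t + i)) with hξd
  have hξ : ∀ i, D.IsOptimalPlan (x (t + i)) (w (t + i)) (ξ i) := fun i =>
    hD.isOptimalPlan_optimalPlan (hall _ (by omega)) _
  set δ := fun i => x (t + i) - D.Pi *ᵥ (ξ i).W 0 with hδd
  set J := fun i => D.cost (w (t + i)) (ξ i) with hJd
  -- the optimal cost decreases by at least the deviation of the state from the artificial regime
  have hdec : ∀ i, J (i + 1) + sqWeight D.Q (δ i) ≤ J i := fun i => by
    obtain ⟨η, hη, hηc⟩ := hD.exists_successor_plan (w (t + i)) (hξ i).1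
    rw [← hw _ (by omega)] at hηc
    rw [← hstep _ (by omega) (hall _ (by omega))] at hη
    have h1 := (hξ (i + 1)).2 η hη
    exact (add_le_add_left h1 _).trans hηc
  have hanti : Antitone J := antitone_nat_of_succ_le fun i => by
    linarith [hdec i, hD.posDef_Q.sqWeight_nonneg (δ i)]
  have hJlim := tendsto_atTop_ciInf hanti
    ⟨0, by rintro _ ⟨i, rfl⟩; exact hD.cost_nonneg _ _⟩
  have hdiff : Tendsto (fun i => J i - J (i + 1)) atTop (𝓝 0) := by
    simpa using hJlim.sub (hJlim.comp (tendsto_add_atTop_nat 1))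
  have hδ : Tendsto δ atTop (𝓝 0) := by
    obtain ⟨c, hc0, hc⟩ := exists_mul_norm_sq_le_sqWeight (M := D.Q)
      fun z hz => hD.posDef_Q.sqWeight_pos hz
    exact tendsto_zero_of_mul_norm_sq_le hc0 (fun i => (hc _).trans (by linarith [hdec i])) hdiff
  have hwsteady : ∀ i, w (t + i) ∈ D.steadyRefs := by
    intro i
    induction i with
    | zero =>
      obtain ⟨x₀, hx₀⟩ := hwt
      exact hD.mem_steadyRefs_of_maxAdmissible hx₀
    | succ i ih =>
      rw [← add_assoc, hw _ (by omega)]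
      simpa using (hD.pow_mem_steadyRefs 1).mpr ih
  obtain ⟨C, η, hη, hoff⟩ := hD.exists_offset_le hN (J 0)
  have hτ : Tendsto (fun i => sqWeight D.T ((ξ i).W 0 - w (t + i))) atTop (𝓝 0) := by
    have h1 : Tendsto (fun i => C * ‖δ i‖ ^ 2) atTop (𝓝 0) := by
      simpa using (hδ.norm.pow 2).const_mul C
    refine squeeze_zero' (Eventually.of_forall fun i => hD.sqWeight_T_nonneg _) ?_ h1
    have h2 : ∀ᶠ i in atTop, ‖δ i‖ < η := by
      simpa using hδ.norm.eventually_lt_const (by simpa using hη)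
    filter_upwards [h2] with i hi
    exact hoff _ _ _ (hξ i) (hwsteady i) (hanti (Nat.zero_le i)) hi
  have hωlim : Tendsto (fun i => (ξ i).W 0 - w (t + i)) atTop (𝓝 0) := by
    obtain ⟨c, hc0, hc⟩ := exists_mul_norm_sq_le_sqWeight (M := D.T)
      fun z hz => hD.sqWeight_T_pos hz
    exact tendsto_zero_of_mul_norm_sq_le hc0 (fun i => hc _) hτ
  have herr : ∀ i, D.trackingError (x (i + t)) (w (i + t))
      = D.C *ᵥ δ i + D.Qe *ᵥ ((ξ i).W 0 - w (t + i)) := fun i => by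
    simp only [hδd, MPCAgent.trackingError, ← hD.regulator_output, Matrix.mulVec_sub,
      ← Matrix.mulVec_mulVec, add_comm i t]
    abel
  rw [← tendsto_add_atTop_iff_nat t]
  simp only [herr]
  have hcont : Continuous fun z : (Fin n → ℝ) × (Fin p → ℝ) => D.C *ᵥ z.1 + D.Qe *ᵥ z.2 := by
    fun_prop
  have hlim := (hcont.tendsto (0, 0)).comp (hδ.prodMk_nhds hωlim)
  simp only [Matrix.mulVec_zero, add_zero] at hlim
  exact hlim
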